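/- Fix integers $q > r \ge 1$. An $r$-graph $G$ is a finite hypergraph, with vertex set $V(G)$ and edge set $E(G)$, all of whose edges are $r$-element subsets of $V(G)$; $K_q^r$ is the $r$-graph with vertex set $[q]$ whose edges are all the $r$-subsets of $[q]$. A $K_q^r$-decomposition of an $r$-graph $G$ is a set of subgraphs of $G$, each isomorphic to $K_q^r$, such that every edge of $G$ lies in exactly one of them. An $r$-graph $G$ is $K_q^r$-divisible if for all $0 \le i \le r-1$ and all $S \subseteq V(G)$ with $|S| = i$, the number $|\{e \in E(G) : S \subseteq e\}|$ is divisible by $\binom{q-i}{r-i}$. A set of vertices is independent in $G$ if it contains no edge of $G$. The union $L \cup A$ has vertex set $V(L) \cup V(A)$ and edge set $E(L) \cup E(A)$. **Theorem (Glock–Kühn–Lo–Osthus).** Let $q > r \ge 1$ be integers. For every $K_q^r$-divisible $r$-graph $L$ (whose vertices, like those of all $r$-graphs here, are taken from a fixed but arbitrary infinite set) there is a $K_q^r$-absorber for $L$, that is, an $r$-graph $A$ with $V(L) \subseteq V(A)$ such that $V(L)$ is independent in $A$ and both $A$ and $L \cup A$ admit $K_q^r$-decompositions. -/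

import Mathlib

/-!
Finite `r`-graphs, decompositions and absorbers, over Mathlib's `Hypergraph`.
-/

namespace Absorbers

/-- `G` is an `r`-graph: a finite hypergraph all of whose edges have exactly `r` vertices. -/
structure IsRGraph {α : Type*} (r : ℕ) (G : Hypergraph α) : Prop where
  finite_vertexSet : G.vertexSet.Finite
  ncard_edge : ∀ e ∈ G.edgeSet, e.ncard = r

/-- The complete `r`-graph `K_q^r` on `q` vertices. -/
def completeRGraph (q r : ℕ) : Hypergraph (Fin q) where
  vertexSet := Set.univ
  edgeSet := {e | e.ncard = r}
  subset_vertexSet_of_mem_edgeSet' := fun e _ => Set.subset_univ e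

/-- The union of two hypergraphs. -/
def union {α : Type*} (G H : Hypergraph α) : Hypergraph α where
  vertexSet := G.vertexSet ∪ H.vertexSet
  edgeSet := G.edgeSet ∪ H.edgeSet
  subset_vertexSet_of_mem_edgeSet' := by
    rintro e (he | he)
    · exact (G.subset_vertexSet_of_mem_edgeSet' he).trans Set.subset_union_left
    · exact (H.subset_vertexSet_of_mem_edgeSet' he).trans Set.subset_union_right

/-- `H` is a subgraph of `G`. -/
def IsSubgraph {α : Type*} (H G : Hypergraph α) : Prop :=
  H.vertexSet ⊆ G.vertexSet ∧ H.edgeSet ⊆ G.edgeSet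

/-- `H` is isomorphic to `F` (it is the image of `F` under an injection of the vertices of `F`). -/
def IsIsomorphicCopy {β α : Type*} (F : Hypergraph β) (H : Hypergraph α) : Prop :=
  ∃ f : β → α, Set.InjOn f F.vertexSet ∧ H = F.image f

/-- `𝒬` is an `F`-decomposition of `G`: a set of copies of `F` in `G` such that every edge of `G`
lies in exactly one of them. -/
def IsDecomposition {β α : Type*} (F : Hypergraph β) (G : Hypergraph α)
    (𝒬 : Set (Hypergraph α)) : Prop :=
  (∀ H ∈ 𝒬, IsIsomorphicCopy F H ∧ IsSubgraph H G) ∧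
    ∀ e ∈ G.edgeSet, ∃! H, H ∈ 𝒬 ∧ e ∈ H.edgeSet

/-- `G` admits an `F`-decomposition. -/
def HasDecomposition {β α : Type*} (F : Hypergraph β) (G : Hypergraph α) : Prop :=
  ∃ 𝒬 : Set (Hypergraph α), IsDecomposition F G 𝒬

/-- The `r`-graph `G` is `K_q^r`-divisible: for `0 ≤ i ≤ r - 1`, the number of edges containing any
given set of `i` vertices of `G` is divisible by `(q - i).choose (r - i)`. -/
def IsDivisible {α : Type*} (q r : ℕ) (G : Hypergraph α) : Prop :=
  ∀ i < r, ∀ S ⊆ G.vertexSet, S.ncard = i →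
    (q - i).choose (r - i) ∣ {e | e ∈ G.edgeSet ∧ S ⊆ e}.ncard

/-- `U` is independent in `G`: it contains no edge of `G`. -/
def IsIndependent {α : Type*} (G : Hypergraph α) (U : Set α) : Prop :=
  ∀ e ∈ G.edgeSet, ¬ e ⊆ U

/-- The `r`-graph `A` is a `K_q^r`-absorber for `L`. -/
structure IsAbsorber {α : Type*} (q r : ℕ) (L A : Hypergraph α) : Prop where
  isRGraph : IsRGraph r A
  vertexSet_subset : L.vertexSet ⊆ A.vertexSet
  isIndependent : IsIndependent A L.vertexSet
  hasDecomposition : HasDecomposition (completeRGraph q r) A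
  hasDecomposition_union : HasDecomposition (completeRGraph q r) (union L A)

end Absorbers

/-!
Write `K Q` for the set of all `r`-subsets of a `q`-set `Q`. An absorber for `L` is obtained from two
families `P`, `N` of `q`-sets with `∑_{Q ∈ P} K Q = L + ∑_{Q ∈ N} K Q`, where both sides are
multiplicity-free and no member of `N` contains an `r`-set of vertices of `L`: then `N` decomposes
the `r`-graph `A` of its own edges, and `P` decomposes `L ∪ A`.

*Integral decomposition.* Without the freeness conditions such families exist as soon as `L` is
divisible (`IsDegreeFunction.exists_families`, `exists_families_of_dvd`). In a signed family `Φ` of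
`q`-sets, let `δ A` be the signed number of members containing `A`. Then `L` prescribes
`δ A = deg_L A / (q - |A|).choose (r - |A|)` for `|A| ≤ r`, which is an integer by divisibility, and
these values satisfy the double-counting identities
`∑_{R ⊇ A, |R| = k} δ R = (q - |A|).choose (k - |A|) * δ A`. Conversely any such `δ` is realised,
level by level: if `δ` vanishes on sets of size less than `j`, subtract `∑_{|R| = j} δ R • (R ∪ F)`,
where `F` is a fixed set of `q - j` fresh vertices. A set `A` with `|A| ≤ j` is contained in members
of total weight `∑_{R ⊇ A \ F} δ R`, a multiple of `δ (A \ F)`. This is zero unless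
`|A \ F| = j`, i.e. `A` has size `j` and avoids `F`, and then it is `δ A`.

*Switching.* Any `q`-sets `S`, `S'` can be completed by families `A`, `B` such that `S, A` and
`S', B` cover the same `r`-sets, each once, and all vertices outside `S ∪ S'` are fresh
(`exists_switch`): view `S` as one codeword of
a Reed–Solomon code with `q` coordinates and dimension `r`, and `S'` as one word of a translate of
this code. The code and its translate each decompose the complete `q`-partite `r`-graph.

*Removing multiplicities.* Let `W` be a finite set containing the initial families. While an `r`-set
`e₀ ⊆ W` lies in a member of `N`, it lies in a member of `P` too. Two switches replace these members
by `S ∈ N` and `S' ∈ P` that contain `e₀` and are otherwise private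
(`IsSimpleOff.exists_fresh`); a switch between `S` and `S'` then removes both, because `S - S'` and
`B - A` have the same coverage (`IsSimpleOff.exists_cancel`). Outside `W` only new `r`-sets are
covered, so multiplicities there stay at most one, and the total coverage of `N` inside `W` drops.
-/

namespace Absorbers

/-! ### Coverage of a set by a family of sets -/

open scoped Classical in
/-- The number of members of the family `P`, counted with multiplicity, that contain `e`. -/
noncomputable def cov {α : Type*} (P : Multiset (Finset α)) (e : Finset α) : ℕ :=
  P.countP (e ⊆ ·)

section Cov

variable {α : Type*}

@[simp] lemma cov_zero (e : Finset α) : cov 0 e = 0 := by simp [cov]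

@[simp] lemma cov_add (P Q : Multiset (Finset α)) (e : Finset α) :
    cov (P + Q) e = cov P e + cov Q e := by
  simp [cov, Multiset.countP_add]

open scoped Classical in
@[simp] lemma cov_cons (S : Finset α) (P : Multiset (Finset α)) (e : Finset α) :
    cov (S ::ₘ P) e = cov P e + if e ⊆ S then 1 else 0 := by
  simp [cov, Multiset.countP_cons]

open scoped Classical in
lemma cov_erase {S : Finset α} {P : Multiset (Finset α)} (hS : S ∈ P) (e : Finset α) :
    cov P e = cov (P.erase S) e + if e ⊆ S then 1 else 0 := by
  conv_lhs => rw [← Multiset.cons_erase hS]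
  rw [cov_cons]

open scoped Classical in
lemma cov_nsmul_singleton (n : ℕ) (S e : Finset α) :
    cov (n • {S}) e = if e ⊆ S then n else 0 := by
  rw [cov, Multiset.countP_nsmul, ← Multiset.cons_zero, Multiset.countP_cons]
  simp

lemma cov_sum {ι : Type*} (s : Finset ι) (P : ι → Multiset (Finset α)) (e : Finset α) :
    cov (∑ i ∈ s, P i) e = ∑ i ∈ s, cov (P i) e := by
  classical
  induction s using Finset.induction_on with
  | empty => simp
  | insert a s ha ih => simp [Finset.sum_insert ha, ih]

lemma cov_pos_iff {P : Multiset (Finset α)} {e : Finset α} :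
    0 < cov P e ↔ ∃ Q ∈ P, e ⊆ Q := by
  simp [cov, Multiset.countP_pos]

end Cov

/-! ### Switches from Reed–Solomon codes -/

section Switch

variable {α : Type*}

/-- Reed–Solomon codes: evaluating the polynomials of degree less than `r` at distinct points of a
large prime field gives a set of functions on `S` that is determined freely by any `r` values. -/
lemma exists_mds_code (S : Finset α) (r : ℕ) :
    ∃ (p : ℕ) (_ : Fact p.Prime) (C : Finset (α → ZMod p)), 0 ∈ C ∧
      ∀ T ⊆ S, T.card = r → ∀ h : α → ZMod p, ∃! f, f ∈ C ∧ ∀ s ∈ T, f s = h s := by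
  classical
  obtain ⟨p, hp, hprime⟩ := Nat.exists_infinite_primes S.card
  have : Fact p.Prime := ⟨hprime⟩
  obtain ⟨v, hv⟩ : ∃ v : α → ZMod p, Set.InjOn v S := by
    obtain ⟨i⟩ : Nonempty (S ↪ ZMod p) := by
      apply Function.Embedding.nonempty_of_card_le
      simpa [ZMod.card] using hp
    refine ⟨fun a => if h : a ∈ S then i ⟨a, h⟩ else 0, fun a ha b hb hab => ?_⟩
    simp only [Finset.mem_coe] at ha hb
    simpa [ha, hb] using hab
  have hfin : (Set.range fun (f : Polynomial.degreeLT (ZMod p) r) (a : α) =>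
      f.1.eval (v a)).Finite := by
    have : Finite (Polynomial.degreeLT (ZMod p) r) :=
      Finite.of_equiv _ (Polynomial.degreeLTEquiv (ZMod p) r).toEquiv.symm
    exact Set.finite_range _
  refine ⟨p, this, hfin.toFinset, ?_, fun T hT hTr h => ?_⟩
  · simp only [Set.Finite.mem_toFinset, Set.mem_range]
    exact ⟨0, by ext; simp⟩
  · have hvT : Set.InjOn v T := hv.mono (by simpa using hT)
    refine ⟨fun a => (Lagrange.interpolate T v h).eval (v a), ⟨?_, fun s hs => ?_⟩, ?_⟩
    · simp only [Set.Finite.mem_toFinset, Set.mem_range]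
      exact ⟨⟨Lagrange.interpolate T v h, Polynomial.mem_degreeLT.2
        (hTr ▸ Lagrange.degree_interpolate_lt h hvT)⟩, rfl⟩
    · exact Lagrange.eval_interpolate_at_node _ hvT hs
    · rintro f ⟨hf, hfh⟩
      simp only [Set.Finite.mem_toFinset, Set.mem_range] at hf
      obtain ⟨⟨f, hfr⟩, rfl⟩ := hf
      rw [Polynomial.mem_degreeLT, ← hTr] at hfr
      rw [← Lagrange.eq_interpolate_of_eval_eq h hvT hfr hfh]

open scoped Classical in
/-- Translating a code by any `g` does not change the `r`-sets covered: these are the transversal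
`r`-sets of the partition with classes `{φ (s, x) | x}`, each covered once. -/
lemma cov_map_code {F : Type*} [AddGroup F] {S : Finset α} {r : ℕ} {C : Finset (α → F)}
    (hC : ∀ T ⊆ S, T.card = r → ∀ h : α → F, ∃! f, f ∈ C ∧ ∀ s ∈ T, f s = h s)
    {φ : α → F → α} (hφ : ∀ s ∈ S, ∀ s' ∈ S, ∀ x x', φ s x = φ s' x' → s = s' ∧ x = x')
    (g : α → F) (e : Finset α) (he : e.card = r) :
    cov (C.val.map fun f => S.image fun s => φ s (f s + g s)) e =
      if ∃ T ⊆ S, ∃ h : α → F, e = T.image (fun s => φ s (h s)) then 1 else 0 := by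
  have hcov : cov (C.val.map fun f => S.image fun s => φ s (f s + g s)) e =
      (C.filter fun f => e ⊆ S.image fun s => φ s (f s + g s)).card := by
    rw [cov, Multiset.countP_map]; rfl
  rw [hcov]
  split_ifs with h
  · obtain ⟨T, hT, h, rfl⟩ := h
    have hinj : Set.InjOn (fun s => φ s (h s)) T := fun s hs s' hs' hss =>
      (hφ s (hT hs) s' (hT hs') _ _ hss).1
    rw [Finset.card_image_of_injOn hinj] at he
    obtain ⟨f, ⟨hf, hfh⟩, huniq⟩ := hC T hT he fun s => h s - g s
    rw [Finset.card_eq_one]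
    refine ⟨f, ?_⟩
    ext f'
    simp only [Finset.mem_filter, Finset.mem_singleton]
    constructor
    · rintro ⟨hf', hsub⟩
      refine huniq _ ⟨hf', fun s hs => ?_⟩
      obtain ⟨s', hs', heq⟩ := Finset.mem_image.1 (hsub (Finset.mem_image_of_mem _ hs))
      obtain ⟨rfl, hx⟩ := hφ _ hs' _ (hT hs) _ _ heq
      exact eq_sub_of_add_eq hx
    · rintro rfl
      refine ⟨hf, fun x hx => ?_⟩
      obtain ⟨s, hs, rfl⟩ := Finset.mem_image.1 hx
      exact Finset.mem_image.2 ⟨s, hT hs, by rw [hfh s hs, sub_add_cancel]⟩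
  · rw [Finset.card_eq_zero, Finset.filter_eq_empty_iff]
    intro f hf hsub
    obtain ⟨T, hT, rfl⟩ := Finset.subset_image_iff.1 hsub
    exact h ⟨T, by simpa using hT, fun s => f s + g s, by ext; simp⟩

open scoped Classical in
/-- Any two `q`-sets `S` and `S'` lie in two families `S, A` and `S', B` of
`q`-sets that cover the same `r`-sets, each at most once. -/
lemma exists_switch [Infinite α] {q r : ℕ} {S S' U : Finset α} (hS : S.card = q)
    (hS' : S'.card = q) (hSU : S ⊆ U) (hSU' : S' ⊆ U) :
    ∃ A B : Multiset (Finset α),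
      (∀ Q ∈ A + B, Q.card = q ∧ ∀ x ∈ Q, x ∈ S ∨ x ∈ S' ∨ x ∉ U) ∧
      ∀ e : Finset α, e.card = r →
        cov A e + (if e ⊆ S then 1 else 0) = cov B e + (if e ⊆ S' then 1 else 0) ∧
        cov A e + (if e ⊆ S then 1 else 0) ≤ 1 := by
  obtain ⟨p, hp, C, h0, hC⟩ := exists_mds_code S r
  -- the bijection `σ` from `S \ S'` to `S' \ S`
  obtain ⟨σ, hσ, hσmem⟩ : ∃ σ : α → α, Set.InjOn σ (S \ S' : Finset α) ∧
      (S \ S').image σ = S' \ S := by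
    have hcard : (S \ S').card = (S' \ S).card := by
      have h1 := Finset.card_sdiff_add_card_inter S S'
      have h2 := Finset.card_sdiff_add_card_inter S' S
      rw [Finset.inter_comm] at h2
      omega
    let ε := Finset.equivOfCardEq hcard
    refine ⟨fun a => if h : a ∈ S \ S' then ε ⟨a, h⟩ else a, fun a ha b hb hab => ?_, ?_⟩
    · simp only [Finset.mem_coe] at ha hb
      simp only [dif_pos ha, dif_pos hb, Subtype.coe_inj] at hab
      simpa using ε.injective hab
    · ext b
      simp only [Finset.mem_image]
      constructor
      · rintro ⟨a, ha, rfl⟩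
        rw [dif_pos ha]
        exact (ε _).2
      · intro hb
        exact ⟨ε.symm ⟨b, hb⟩, (ε.symm ⟨b, hb⟩).2, by simp⟩
  -- fresh names `τ` for all other vertices of the gadget
  obtain ⟨τ, hτ, hτU⟩ : ∃ τ : α × ZMod p → α,
      Set.InjOn τ (S ×ˢ Finset.univ : Finset (α × ZMod p)) ∧
      ∀ a ∈ (S ×ˢ Finset.univ : Finset (α × ZMod p)), τ a ∉ U := by
    obtain ⟨t, htU, ht⟩ := (Finset.finite_toSet U).infinite_compl.exists_subset_card_eq
      (S ×ˢ (Finset.univ : Finset (ZMod p))).card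
    let ε := Finset.equivOfCardEq ht.symm
    refine ⟨fun a => if h : a ∈ S ×ˢ (Finset.univ : Finset (ZMod p)) then ε ⟨a, h⟩ else a.1,
      fun a ha b hb hab => ?_, fun a ha => ?_⟩
    · simp only [Finset.mem_coe] at ha hb
      simp only [dif_pos ha, dif_pos hb, Subtype.coe_inj] at hab
      simpa using ε.injective hab
    · simp only [dif_pos ha]
      exact htU (ε _).2
  -- the class of `s ∈ S`: `0` names `s` itself and `1` its partner in `S'`, if that differs from `s`
  let φ : α → ZMod p → α := fun s x =>
    if x = 0 then s else if x = 1 ∧ s ∉ S' then σ s else τ (s, x)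
  let g : α → ZMod p := fun s => if s ∈ S' then 0 else 1
  have hσ' : ∀ s ∈ S, s ∉ S' → σ s ∈ S' ∧ σ s ∉ S := fun s hs hs' =>
    Finset.mem_sdiff.1 (hσmem ▸ Finset.mem_image_of_mem σ (Finset.mem_sdiff.2 ⟨hs, hs'⟩))
  have hτ' : ∀ s ∈ S, ∀ x, τ (s, x) ∉ U := fun s hs x => hτU _ (by simp [hs])
  have hφ : ∀ s ∈ S, ∀ s' ∈ S, ∀ x x', φ s x = φ s' x' → s = s' ∧ x = x' := by
    intro s hs s' hs' x x' h
    have k1 := hσ' s hs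
    have k2 := hσ' s' hs'
    have k3 := hτ' s hs x
    have k4 := hτ' s' hs' x'
    have k5 : s ∉ S' → s' ∉ S' → σ s = σ s' → s = s' := fun h1 h2 h3 =>
      hσ (by simp [hs, h1]) (by simp [hs', h2]) h3
    have k6 : τ (s, x) = τ (s', x') → s = s' ∧ x = x' := fun h3 => by
      simpa using hτ (by simp [hs]) (by simp [hs']) h3
    have := @hSU s hs
    have := @hSU s' hs'
    have := @hSU' (σ s)
    have := @hSU' (σ s')
    simp only [φ] at h
    grind
  have hφmem : ∀ s ∈ S, ∀ x, φ s x ∈ S ∨ φ s x ∈ S' ∨ φ s x ∉ U := by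
    intro s hs x
    have k1 := hσ' s hs
    have k3 := hτ' s hs x
    simp only [φ]
    grind
  -- the words of the code translated by `g`, as `q`-sets; `S` is the zero word, `S'` the word `g`
  let D : (α → ZMod p) → Multiset (Finset α) := fun g =>
    C.val.map fun f => S.image fun s => φ s (f s + g s)
  have hD : ∀ g, ∀ Q ∈ D g, Q.card = q ∧ ∀ x ∈ Q, x ∈ S ∨ x ∈ S' ∨ x ∉ U := by
    intro g Q hQ
    obtain ⟨f, -, rfl⟩ := Multiset.mem_map.1 hQ
    refine ⟨?_, fun x hx => ?_⟩
    · rw [Finset.card_image_of_injOn, hS]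
      exact fun s hs s' hs' h => (hφ s hs s' hs' _ _ h).1
    · obtain ⟨s, hs, rfl⟩ := Finset.mem_image.1 hx
      exact hφmem s hs _
  have hSmem : S ∈ D 0 :=
    Multiset.mem_map.2 ⟨0, h0, by simp [φ]⟩
  have hSmem' : S' ∈ D g := by
    refine Multiset.mem_map.2 ⟨0, h0, ?_⟩
    ext b
    have hb := Finset.ext_iff.1 hσmem b
    simp only [Finset.mem_image, Finset.mem_sdiff] at hb
    simp only [Finset.mem_image, φ, g, Pi.zero_apply, zero_add]
    constructor
    · rintro ⟨s, hs, rfl⟩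
      by_cases hs' : s ∈ S'
      · simp [hs']
      · simpa [hs'] using (hσ' s hs hs').1
    · intro hbS'
      by_cases hbS : b ∈ S
      · exact ⟨b, hbS, by simp [hbS']⟩
      · obtain ⟨s, ⟨hs, hs'⟩, rfl⟩ := hb.2 ⟨hbS', hbS⟩
        exact ⟨s, hs, by simp [hs']⟩
  refine ⟨(D 0).erase S, (D g).erase S', fun Q hQ => ?_, fun e he => ?_⟩
  · rcases Multiset.mem_add.1 hQ with hQ | hQ
    · exact hD _ _ (Multiset.mem_of_mem_erase hQ)
    · exact hD _ _ (Multiset.mem_of_mem_erase hQ)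
  · rw [← cov_erase hSmem, ← cov_erase hSmem', cov_map_code hC hφ _ e he,
      cov_map_code hC hφ _ e he]
    exact ⟨rfl, by split_ifs <;> simp⟩

end Switch

/-! ### Cancelling multiplicities -/

section Surgery

variable {α : Type*}

/-- `P` and `N` are families of `q`-sets that cover every `r`-set outside `W` at most once. -/
structure IsSimpleOff (q r : ℕ) (W : Finset α) (P N : Multiset (Finset α)) : Prop where
  card_eq : ∀ Q ∈ P + N, Q.card = q
  left_le : ∀ e : Finset α, e.card = r → ¬ e ⊆ W → cov P e ≤ 1
  right_le : ∀ e : Finset α, e.card = r → ¬ e ⊆ W → cov N e ≤ 1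

lemma IsSimpleOff.symm {q r : ℕ} {W : Finset α} {P N : Multiset (Finset α)}
    (h : IsSimpleOff q r W P N) : IsSimpleOff q r W N P :=
  ⟨fun Q hQ => h.card_eq Q (by rwa [add_comm]), h.right_le, h.left_le⟩

lemma cov_eq_zero_of_notMem {P : Multiset (Finset α)} {e : Finset α} {x : α} (hx : x ∈ e)
    (h : ∀ Q ∈ P, x ∉ Q) : cov P e = 0 := by
  by_contra h0
  obtain ⟨Q, hQ, heQ⟩ := cov_pos_iff.1 (Nat.pos_of_ne_zero h0)
  exact h Q hQ (heQ hx)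

lemma exists_forall_subset (P : Multiset (Finset α)) : ∃ U : Finset α, ∀ Q ∈ P, Q ⊆ U := by
  classical
  exact ⟨P.toFinset.biUnion id, fun Q hQ =>
    Finset.subset_biUnion_of_mem id (Multiset.mem_toFinset.2 hQ)⟩

lemma exists_card_eq_disjoint [Infinite α] (U : Finset α) (n : ℕ) :
    ∃ F : Finset α, F.card = n ∧ ∀ x ∈ F, x ∉ U := by
  obtain ⟨t, htU, ht⟩ := (Finset.finite_toSet U).infinite_compl.exists_subset_card_eq n
  exact ⟨t, ht, fun x hx => by simpa using htU hx⟩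

/-- A member `S` of `N` that contains `e₀` can be traded for one that is otherwise disjoint from a
given finite set `U`, while the coverage inside `W` stays the same. -/
lemma IsSimpleOff.exists_fresh [Infinite α] {q r : ℕ} {W : Finset α} {P N : Multiset (Finset α)}
    (h : IsSimpleOff q r W P N) {S e₀ : Finset α} (hS : S ∈ N) (heS : e₀ ⊆ S)
    (he₀ : e₀.card = r) (U : Finset α) :
    ∃ (P' N' : Multiset (Finset α)) (S' : Finset α), IsSimpleOff q r W P' N' ∧
      S' ∈ N' ∧ e₀ ⊆ S' ∧ (∀ x ∈ S', x ∉ e₀ → x ∉ U) ∧ P ≤ P' ∧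
      (∀ e : Finset α, e.card = r → cov P' e + cov N e = cov P e + cov N' e) ∧
      (∀ e ⊆ W, e.card = r → cov N' e = cov N e) ∧
      ∀ Q ∈ P' + N', Q ∈ P + N ∨ ∀ x ∈ Q, x ∈ S ∨ x ∉ U := by
  classical
  obtain ⟨V, hV⟩ := exists_forall_subset (P + N)
  have hSq : S.card = q := h.card_eq S (by simp [hS])
  have hSV : S ⊆ V := hV S (by simp [hS])
  obtain ⟨F, hF, hFU⟩ := exists_card_eq_disjoint (U ∪ V ∪ W) (q - r)
  have hle : e₀.card ≤ S.card := Finset.card_le_card heS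
  have hFd : Disjoint e₀ F := by
    rw [Finset.disjoint_left]
    intro x hx hxF
    have := hFU x hxF
    simp only [Finset.mem_union, not_or] at this
    exact this.1.2 (hSV (heS hx))
  have hS'q : (e₀ ∪ F).card = q := by
    rw [Finset.card_union_of_disjoint hFd]; omega
  obtain ⟨A, B, hAB, hcov⟩ := exists_switch (r := r) (U := U ∪ V ∪ W ∪ F) hSq hS'q
    (fun x hx => by simp [hSV hx])
    (fun x hx => by
      rcases Finset.mem_union.1 hx with hx | hx
      · simp [hSV (heS hx)]
      · simp [hx])
  have hV' : ∀ Q ∈ A + B, ∀ x ∈ Q, x ∈ S ∨ (x ∉ U ∧ x ∉ V ∧ x ∉ W) := by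
    intro Q hQ x hx
    have h1 := (hAB Q hQ).2 x hx
    have h2 := hFU x
    have h3 := @heS x
    simp only [Finset.mem_union] at h1 h2
    tauto
  -- an `r`-set covered by `A` has a vertex that no member of `P` or `N` contains
  have hA : ∀ e : Finset α, e.card = r → cov A e = 0 ∨
      cov A e = 1 ∧ ¬ e ⊆ W ∧ cov P e = 0 ∧ cov N e = 0 := by
    intro e he
    obtain h0 | hpos := Nat.eq_zero_or_pos (cov A e)
    · exact Or.inl h0
    · have h1 := (hcov e he).2
      have heS : ¬ e ⊆ S := fun hs => by rw [if_pos hs] at h1; omega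
      obtain ⟨x, hxe, hxS⟩ := Finset.not_subset.1 heS
      obtain ⟨Q, hQ, heQ⟩ := cov_pos_iff.1 hpos
      have hx := (hV' Q (by simp [hQ]) x (heQ hxe)).resolve_left hxS
      refine Or.inr ⟨by omega, fun hW => hx.2.2 (hW hxe), ?_, ?_⟩
      · exact cov_eq_zero_of_notMem hxe fun Q hQ hxQ => hx.2.1 (hV Q (by simp [hQ]) hxQ)
      · exact cov_eq_zero_of_notMem hxe fun Q hQ hxQ => hx.2.1 (hV Q (by simp [hQ]) hxQ)
  have hN : ∀ e : Finset α, e.card = r →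
      cov ((e₀ ∪ F) ::ₘ (N.erase S + B)) e = cov N e + cov A e := by
    intro e he
    have h1 := hcov e he
    rw [cov_erase hS, cov_cons, cov_add]
    omega
  refine ⟨P + A, (e₀ ∪ F) ::ₘ (N.erase S + B), e₀ ∪ F, ⟨fun Q hQ => ?_, fun e he heW => ?_,
    fun e he heW => ?_⟩, by simp, Finset.subset_union_left, fun x hx hx0 => ?_,
    Multiset.le_add_right _ _, fun e he => ?_, fun e heW he => ?_, fun Q hQ => ?_⟩
  · simp only [Multiset.mem_add, Multiset.mem_cons] at hQ
    rcases hQ with (hQ | hQ) | rfl | hQ | hQ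
    · exact h.card_eq Q (by simp [hQ])
    · exact (hAB Q (by simp [hQ])).1
    · exact hS'q
    · exact h.card_eq Q (by simp [Multiset.mem_of_mem_erase hQ])
    · exact (hAB Q (by simp [hQ])).1
  · have := h.left_le e he heW
    rw [cov_add]
    rcases hA e he with h1 | h1 <;> omega
  · have := h.right_le e he heW
    rw [hN e he]
    rcases hA e he with h1 | h1 <;> omega
  · have := hFU x ((Finset.mem_union.1 hx).resolve_left hx0)
    simp only [Finset.mem_union, not_or] at this
    exact this.1.1
  · rw [hN e he, cov_add]; omega
  · rw [hN e he]
    rcases hA e he with h1 | h1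
    · omega
    · exact absurd heW h1.2.1
  · simp only [Multiset.mem_add, Multiset.mem_cons] at hQ
    rcases hQ with (hQ | hQ) | rfl | hQ | hQ
    · exact Or.inl (by simp [hQ])
    · exact Or.inr fun x hx => (hV' Q (by simp [hQ]) x hx).imp_right fun h => h.1
    · refine Or.inr fun x hx => ?_
      rcases Finset.mem_union.1 hx with hx | hx
      · exact Or.inl (heS hx)
      · have := hFU x hx
        simp only [Finset.mem_union, not_or] at this
        exact Or.inr this.1.1
    · exact Or.inl (by simp [Multiset.mem_of_mem_erase hQ])
    · exact Or.inr fun x hx => (hV' Q (by simp [hQ]) x hx).imp_right fun h => h.1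

/-- If `S ∈ N` and `S' ∈ P` share exactly the edge `e₀`, and no member of `P` or `N` joins the rest
of `S` to the rest of `S'`, then both can be removed at the price of covering new `r`-sets. -/
lemma IsSimpleOff.exists_cancel [Infinite α] {q r : ℕ} {W : Finset α}
    {P N : Multiset (Finset α)} (h : IsSimpleOff q r W P N) {S S' e₀ : Finset α} (hS : S ∈ N)
    (hS' : S' ∈ P) (heS : e₀ ⊆ S) (heS' : e₀ ⊆ S') (he₀ : e₀.card = r)
    (hSW' : ∀ x ∈ S', x ∉ e₀ → x ∉ W)
    (hsep : ∀ Q ∈ P + N, ∀ x ∈ S, x ∉ e₀ → ∀ y ∈ S', y ∉ e₀ → x ∈ Q → y ∉ Q) :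
    ∃ P' N' : Multiset (Finset α), IsSimpleOff q r W P' N' ∧
      (∀ e : Finset α, e.card = r → cov P' e + cov N e = cov P e + cov N' e) ∧
      (∀ e ⊆ W, e.card = r → cov N' e ≤ cov N e) ∧ cov N' e₀ < cov N e₀ := by
  classical
  obtain ⟨V, hV⟩ := exists_forall_subset (P + N)
  have hSV : S ⊆ V := hV S (by simp [hS])
  have hSV' : S' ⊆ V := hV S' (by simp [hS'])
  obtain ⟨A, B, hAB, hcov⟩ := exists_switch (r := r) (U := V ∪ W)
    (h.card_eq S (by simp [hS])) (h.card_eq S' (by simp [hS']))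
    (hSV.trans Finset.subset_union_left) (hSV'.trans Finset.subset_union_left)
  -- an `r`-set covered by `A` lies in `S'` or has not been covered before
  have hA : ∀ e : Finset α, e.card = r → cov A e = 0 ∨
      cov A e = 1 ∧ ¬ e ⊆ W ∧ (e ⊆ S' ∨ cov P e = 0 ∧ cov N e = 0) := by
    intro e he
    obtain h0 | hpos := Nat.eq_zero_or_pos (cov A e)
    · exact Or.inl h0
    · have h1 := (hcov e he).2
      have hneS : ¬ e ⊆ S := fun hs => by rw [if_pos hs] at h1; omega
      obtain ⟨x, hxe, hxS⟩ := Finset.not_subset.1 hneS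
      obtain ⟨Q, hQ, heQ⟩ := cov_pos_iff.1 hpos
      have hQm : ∀ y ∈ e, y ∈ S ∨ y ∈ S' ∨ y ∉ V ∪ W := fun y hy =>
        (hAB Q (by simp [hQ])).2 y (heQ hy)
      have hx0 : x ∉ e₀ := fun hx => hxS (heS hx)
      refine Or.inr ⟨by omega, fun hW => ?_, ?_⟩
      · rcases (hQm x hxe).resolve_left hxS with hx | hx
        · exact hSW' x hx hx0 (hW hxe)
        · exact hx (Finset.mem_union_right _ (hW hxe))
      · by_cases hsub : e ⊆ S'
        · exact Or.inl hsub
        · obtain ⟨y, hye, hyS'⟩ := Finset.not_subset.1 hsub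
          have key : ∀ Q ∈ P + N, ¬ e ⊆ Q := by
            intro Q hQ heQ
            rcases (hQm x hxe).resolve_left hxS with hx | hx
            · rcases hQm y hye with hy | hy | hy
              · exact hsep Q hQ y hy (fun h => hyS' (heS' h)) x hx hx0 (heQ hye) (heQ hxe)
              · exact hyS' hy
              · exact hy (Finset.mem_union_left _ (hV Q hQ (heQ hye)))
            · exact hx (Finset.mem_union_left _ (hV Q hQ (heQ hxe)))
          refine Or.inr ⟨?_, ?_⟩ <;> by_contra h0 <;>
            obtain ⟨Q, hQ, heQ⟩ := cov_pos_iff.1 (Nat.pos_of_ne_zero h0) <;>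
            exact key Q (by simp [hQ]) heQ
  have hN : ∀ e : Finset α, e.card = r →
      cov (N.erase S + B) e + (if e ⊆ S' then 1 else 0) = cov N e + cov A e := by
    intro e he
    have h1 := hcov e he
    rw [cov_erase hS, cov_add]
    omega
  have hP : ∀ e : Finset α, cov (P.erase S' + A) e + (if e ⊆ S' then 1 else 0) =
      cov P e + cov A e := by
    intro e
    rw [cov_erase hS', cov_add]
    omega
  refine ⟨P.erase S' + A, N.erase S + B, ⟨fun Q hQ => ?_, fun e he heW => ?_,
    fun e he heW => ?_⟩, fun e he => ?_, fun e heW he => ?_, ?_⟩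
  · simp only [Multiset.mem_add] at hQ
    rcases hQ with (hQ | hQ) | hQ | hQ
    · exact h.card_eq Q (by simp [Multiset.mem_of_mem_erase hQ])
    · exact (hAB Q (by simp [hQ])).1
    · exact h.card_eq Q (by simp [Multiset.mem_of_mem_erase hQ])
    · exact (hAB Q (by simp [hQ])).1
  · have h1 := h.left_le e he heW
    have h2 := hP e
    rcases hA e he with h3 | ⟨h3, -, h4 | h4⟩
    · omega
    · rw [if_pos h4] at h2; omega
    · omega
  · have h1 := h.right_le e he heW
    have h2 := hN e he
    rcases hA e he with h3 | ⟨h3, -, h4 | h4⟩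
    · omega
    · rw [if_pos h4] at h2; omega
    · omega
  · have h1 := hN e he
    have h2 := hP e
    omega
  · have h1 := hN e he
    rcases hA e he with h3 | h3
    · omega
    · exact absurd heW h3.2.1
  · have h1 := hN e₀ he₀
    have h2 := (hcov e₀ he₀).2
    rw [if_pos heS] at h2
    rw [if_pos heS'] at h1
    omega

/-- As long as an `r`-set `e₀ ⊆ W` is covered by both families, its coverage can be lowered. -/
lemma IsSimpleOff.exists_reduce [Infinite α] {q r : ℕ} {W : Finset α}
    {P N : Multiset (Finset α)} (h : IsSimpleOff q r W P N) {e₀ : Finset α} (heW : e₀ ⊆ W)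
    (he₀ : e₀.card = r) (hP : 0 < cov P e₀) (hN : 0 < cov N e₀) :
    ∃ P' N' : Multiset (Finset α), IsSimpleOff q r W P' N' ∧
      (∀ e : Finset α, e.card = r → cov P' e + cov N e = cov P e + cov N' e) ∧
      (∀ e ⊆ W, e.card = r → cov N' e ≤ cov N e) ∧ cov N' e₀ < cov N e₀ := by
  classical
  obtain ⟨S, hS, heS⟩ := cov_pos_iff.1 hN
  obtain ⟨S', hS', heS'⟩ := cov_pos_iff.1 hP
  -- make the member of `N` private outside `e₀`, then the member of `P`
  obtain ⟨P₁, N₁, T, h₁, hT, heT, hTU, hPP₁, hc₁, hW₁, -⟩ := h.exists_fresh hS heS he₀ S'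
  obtain ⟨V, hV⟩ := exists_forall_subset (P₁ + N₁)
  obtain ⟨N₂, P₂, T', h₂, hT', heT', hTU', hNN₂, hc₂, hW₂, hQ₂⟩ :=
    h₁.symm.exists_fresh (Multiset.mem_of_le hPP₁ hS') heS' he₀ (V ∪ W)
  have hTV : T ⊆ V := hV T (by simp [hT])
  obtain ⟨P₃, N₃, h₃, hc₃, hW₃, hlt⟩ := h₂.symm.exists_cancel (Multiset.mem_of_le hNN₂ hT) hT'
    heT heT' he₀ (fun x hx hx0 hxW => hTU' x hx hx0 (Finset.mem_union_right _ hxW))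
    (fun Q hQ x hx hx0 y hy hy0 hxQ hyQ => by
      rw [add_comm] at hQ
      rcases hQ₂ Q hQ with hQ | hQ
      · exact hTU' y hy hy0 (Finset.mem_union_left _ (hV Q (by rwa [add_comm]) hyQ))
      · rcases hQ x hxQ with hxS | hxV
        · exact hTU x hx hx0 hxS
        · exact hxV (Finset.mem_union_left _ (hTV hx)))
  have hN₂ : ∀ e ⊆ W, e.card = r → cov N₂ e = cov N e := fun e heW he => by
    have := hc₂ e he
    have := hW₂ e heW he
    have := hW₁ e heW he
    omega
  refine ⟨P₃, N₃, h₃, fun e he => ?_, fun e heW he => ?_, ?_⟩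
  · have := hc₁ e he
    have := hc₂ e he
    have := hc₃ e he
    omega
  · exact hN₂ e heW he ▸ hW₃ e heW he
  · exact hN₂ e₀ heW he₀ ▸ hlt

/-- All coverage of `r`-sets in `W` by `N` can be cancelled. -/
lemma IsSimpleOff.exists_cov_eq_zero [Infinite α] {q r : ℕ} {W : Finset α} (m : ℕ) :
    ∀ {P N : Multiset (Finset α)}, IsSimpleOff q r W P N →
    (∀ e ⊆ W, e.card = r → cov N e ≤ cov P e) →
    ∑ e ∈ W.powersetCard r, cov N e = m →
    ∃ P' N' : Multiset (Finset α), IsSimpleOff q r W P' N' ∧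
      (∀ e : Finset α, e.card = r → cov P' e + cov N e = cov P e + cov N' e) ∧
      ∀ e ⊆ W, e.card = r → cov N' e = 0 := by
  induction m using Nat.strong_induction_on with
  | _ m ih =>
  intro P N h hle hm
  by_cases h0 : ∀ e ⊆ W, e.card = r → cov N e = 0
  · exact ⟨P, N, h, fun e _ => rfl, h0⟩
  · push Not at h0
    obtain ⟨e₀, heW, he₀, hne⟩ := h0
    have hpos := Nat.pos_of_ne_zero hne
    obtain ⟨P₁, N₁, h₁, hc₁, hl₁, hlt⟩ :=
      h.exists_reduce heW he₀ (hpos.trans_le (hle e₀ heW he₀)) hpos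
    have hsum : ∑ e ∈ W.powersetCard r, cov N₁ e < m := by
      rw [← hm]
      refine Finset.sum_lt_sum (fun e he => ?_) ⟨e₀, Finset.mem_powersetCard.2 ⟨heW, he₀⟩, hlt⟩
      exact hl₁ e (Finset.mem_powersetCard.1 he).1 (Finset.mem_powersetCard.1 he).2
    obtain ⟨P₂, N₂, h₂, hc₂, hz⟩ := ih _ hsum h₁ (fun e heW he => by
      have := hc₁ e he
      have := hle e heW he
      omega) rfl
    exact ⟨P₂, N₂, h₂, fun e he => by have := hc₁ e he; have := hc₂ e he; omega, hz⟩

end Surgery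

/-! ### Integral decompositions of divisible `r`-graphs -/

section Integral

variable {α : Type*}

open scoped Classical in
lemma card_filter_powersetCard_between {V Q A : Finset α} (hQ : Q ⊆ V) (hA : A ⊆ Q) {k : ℕ}
    (hk : A.card ≤ k) :
    ((V.powersetCard k).filter fun R => A ⊆ R ∧ R ⊆ Q).card =
      (Q.card - A.card).choose (k - A.card) := by
  rw [← Finset.card_sdiff_of_subset hA, ← Finset.card_powersetCard]
  refine Finset.card_nbij' (· \ A) (· ∪ A) ?_ ?_ ?_ ?_
  · intro R hR
    simp only [Finset.coe_filter, Finset.mem_powersetCard, Set.mem_ofPred_eq] at hR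
    simp only [Finset.mem_coe, Finset.mem_powersetCard]
    exact ⟨Finset.sdiff_subset_sdiff hR.2.2 subset_rfl, by
      rw [Finset.card_sdiff_of_subset hR.2.1, hR.1.2]⟩
  · intro R hR
    simp only [Finset.mem_coe, Finset.mem_powersetCard] at hR
    have hd : Disjoint R A := Finset.disjoint_of_subset_left hR.1 Finset.sdiff_disjoint
    have hs : R ∪ A ⊆ Q := Finset.union_subset (hR.1.trans Finset.sdiff_subset) hA
    simp only [Finset.coe_filter, Finset.mem_powersetCard, Set.mem_ofPred_eq]
    exact ⟨⟨hs.trans hQ, by rw [Finset.card_union_of_disjoint hd]; omega⟩,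
      Finset.subset_union_right, hs⟩
  · intro R hR
    simp only [Finset.coe_filter, Finset.mem_powersetCard, Set.mem_ofPred_eq] at hR
    exact Finset.sdiff_union_of_subset hR.2.1
  · intro R hR
    simp only [Finset.mem_coe, Finset.mem_powersetCard] at hR
    exact Finset.union_sdiff_cancel_right
      (Finset.disjoint_of_subset_left hR.1 Finset.sdiff_disjoint)

open scoped Classical in
lemma sum_powersetCard_indicator {V Q A : Finset α} (hQ : Q ⊆ V) {k : ℕ} (hk : A.card ≤ k) :
    ∑ R ∈ V.powersetCard k with A ⊆ R, (if R ⊆ Q then (1 : ℤ) else 0) =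
      (Q.card - A.card).choose (k - A.card) * if A ⊆ Q then 1 else 0 := by
  rw [← Finset.sum_filter, Finset.filter_filter, Finset.sum_const]
  split_ifs with hA
  · rw [card_filter_powersetCard_between hQ hA hk]; simp
  · rw [Finset.filter_eq_empty_iff.2]
    · simp
    · rintro R - ⟨h1, h2⟩
      exact hA (h1.trans h2)

open scoped Classical in
/-- `δ` satisfies the double-counting identities of the numbers `δ A` of members containing `A` in a
signed family of `q`-subsets of `W`, up to level `r`. -/
structure IsDegreeFunction (q r : ℕ) (W : Finset α) (δ : Finset α → ℤ) : Prop where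
  eq_zero : ∀ A, ¬ A ⊆ W → δ A = 0
  sum_eq : ∀ (A : Finset α) (k : ℕ), A.card ≤ k → k ≤ r →
    ∑ R ∈ W.powersetCard k with A ⊆ R, δ R = (q - A.card).choose (k - A.card) * δ A

lemma IsDegreeFunction.mono {q r : ℕ} {W V : Finset α} {δ : Finset α → ℤ}
    (h : IsDegreeFunction q r W δ) (hWV : W ⊆ V) : IsDegreeFunction q r V δ := by
  classical
  refine ⟨fun A hA => h.eq_zero A fun hAW => hA (hAW.trans hWV), fun A k hAk hk => ?_⟩
  rw [← h.sum_eq A k hAk hk]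
  symm
  refine Finset.sum_subset (fun R hR => ?_) (fun R hR hR' => h.eq_zero R fun hRW => hR' ?_)
  · simp only [Finset.mem_filter, Finset.mem_powersetCard] at hR ⊢
    exact ⟨⟨hR.1.1.trans hWV, hR.1.2⟩, hR.2⟩
  · simp only [Finset.mem_filter, Finset.mem_powersetCard] at hR ⊢
    exact ⟨⟨hRW, hR.1.2⟩, hR.2⟩

open scoped Classical in
/-- Subtracting a signed family of `q`-subsets of `W` preserves degree functions. -/
lemma IsDegreeFunction.sub_sum {ι : Type*} {q r : ℕ} {W : Finset α} {δ : Finset α → ℤ}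
    (h : IsDegreeFunction q r W δ) (s : Finset ι) (c : ι → ℤ) (Q : ι → Finset α)
    (hQW : ∀ i ∈ s, Q i ⊆ W) (hQ : ∀ i ∈ s, (Q i).card = q) :
    IsDegreeFunction q r W fun A => δ A - ∑ i ∈ s, c i * if A ⊆ Q i then 1 else 0 := by
  refine ⟨fun A hA => ?_, fun A k hAk hk => ?_⟩
  · rw [h.eq_zero A hA, zero_sub, neg_eq_zero]
    refine Finset.sum_eq_zero fun i hi => ?_
    rw [if_neg fun hAQ => hA (hAQ.trans (hQW i hi)), mul_zero]
  · rw [Finset.sum_sub_distrib, h.sum_eq A k hAk hk, mul_sub, Finset.sum_comm, Finset.mul_sum]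
    congr 1
    refine Finset.sum_congr rfl fun i hi => ?_
    rw [← Finset.mul_sum, sum_powersetCard_indicator (hQW i hi) hAk, hQ i hi]
    ring

/-- A degree function is the degree function of a difference of two families of `q`-sets. The
induction is on the number `m` of levels `r - m + 1, …, r` on which `δ` may be nonzero. -/
lemma IsDegreeFunction.exists_families [Infinite α] {q r : ℕ} (hqr : r ≤ q) (m : ℕ) :
    ∀ {W : Finset α} {δ : Finset α → ℤ}, IsDegreeFunction q r W δ →
    (∀ A : Finset α, A.card + m ≤ r → δ A = 0) →
    ∃ P N : Multiset (Finset α), (∀ Q ∈ P + N, Q.card = q) ∧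
      ∀ A : Finset α, A.card ≤ r → (cov P A : ℤ) - cov N A = δ A := by
  classical
  induction m with
  | zero =>
    intro W δ _ h0
    exact ⟨0, 0, by simp, fun A hA => by simp [h0 A hA]⟩
  | succ m ih =>
    intro W δ hδ h0
    -- if `r < m` there is no set of size `r - m` left to treat
    by_cases hm : r < m
    · exact ih hδ fun A hA => by omega
    obtain ⟨j, hj⟩ : ∃ j, j + m = r := ⟨r - m, by omega⟩
    obtain ⟨F, hF, hFW⟩ := exists_card_eq_disjoint W (q - j)
    let s := W.powersetCard j
    have hs : ∀ R ∈ s, (R ∪ F).card = q := fun R hR => by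
      have hR := Finset.mem_powersetCard.1 hR
      rw [Finset.card_union_of_disjoint]
      · omega
      · exact Finset.disjoint_left.2 fun x hx hxF => hFW x hxF (hR.1 hx)
    have hsW : ∀ R ∈ s, R ∪ F ⊆ W ∪ F := fun R hR =>
      Finset.union_subset_union_left (Finset.mem_powersetCard.1 hR).1
    have hδ' := (hδ.mono (V := W ∪ F) Finset.subset_union_left).sub_sum s δ (· ∪ F) hsW hs
    obtain ⟨P, N, hPN, hcov⟩ := ih hδ' fun A hA => by
      have hsum : ∑ R ∈ s, δ R * (if A ⊆ R ∪ F then 1 else 0) =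
          (q - (A \ F).card).choose (j - (A \ F).card) * δ (A \ F) := by
        rw [← hδ.sum_eq (A \ F) j
          ((Finset.card_le_card Finset.sdiff_subset).trans (by omega)) (by omega)]
        rw [Finset.sum_filter]
        refine Finset.sum_congr rfl fun R hR => ?_
        simp [sdiff_le_iff, Finset.union_comm]
      rw [hsum, sub_eq_zero]
      -- `A` keeps its value only if it has size `j` and avoids `F`; else both terms vanish
      by_cases hAF : Disjoint A F
      · rw [Finset.sdiff_eq_self_of_disjoint hAF]
        obtain hlt | heq := Nat.lt_or_ge A.card j
        · rw [h0 A (by omega), mul_zero]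
        · rw [show j - A.card = 0 by omega]; simp
      · obtain ⟨x, hxA, hxF⟩ := Finset.not_disjoint_iff.1 hAF
        have hlt : (A \ F).card < A.card :=
          Finset.card_lt_card (Finset.ssubset_iff_of_subset Finset.sdiff_subset |>.2
            ⟨x, hxA, by simp [hxF]⟩)
        rw [hδ.eq_zero A fun hAW => hFW x hxF (hAW hxA), h0 (A \ F) (by omega), mul_zero]
    refine ⟨P + ∑ R ∈ s, (δ R).toNat • {R ∪ F}, N + ∑ R ∈ s, (-δ R).toNat • {R ∪ F},
      fun Q hQ => ?_, fun A hA => ?_⟩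
    · simp only [Multiset.mem_add, Multiset.mem_sum] at hQ
      rcases hQ with (hQ | ⟨R, hR, hQ⟩) | hQ | ⟨R, hR, hQ⟩
      · exact hPN Q (by simp [hQ])
      · rw [Multiset.mem_singleton.1 (Multiset.mem_of_mem_nsmul hQ)]; exact hs R hR
      · exact hPN Q (by simp [hQ])
      · rw [Multiset.mem_singleton.1 (Multiset.mem_of_mem_nsmul hQ)]; exact hs R hR
    · have h1 := hcov A hA
      have h2 : ∑ R ∈ s, δ R * (if A ⊆ R ∪ F then 1 else 0) =
          ((∑ R ∈ s, cov ((δ R).toNat • {R ∪ F}) A : ℕ) : ℤ) -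
            (∑ R ∈ s, cov ((-δ R).toNat • {R ∪ F}) A : ℕ) := by
        push_cast
        rw [← Finset.sum_sub_distrib]
        refine Finset.sum_congr rfl fun R _ => ?_
        rw [cov_nsmul_singleton, cov_nsmul_singleton]
        split_ifs
        · simp
        · simp
      simp only [cov_add, cov_sum]
      push_cast at h2 ⊢
      linarith

open scoped Classical in
/-- A divisible `r`-graph, with finite edge set `E`, is an integer combination of copies of
`K_q^r`. -/
lemma exists_families_of_dvd [Infinite α] {q r : ℕ} (hqr : r ≤ q) (E : Finset (Finset α))
    (hE : ∀ e ∈ E, e.card = r)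
    (hdvd : ∀ A : Finset α, A.card < r →
      (q - A.card).choose (r - A.card) ∣ (E.filter (A ⊆ ·)).card) :
    ∃ P N : Multiset (Finset α), (∀ Q ∈ P + N, Q.card = q) ∧
      ∀ e : Finset α, e.card = r → cov P e = cov N e + if e ∈ E then 1 else 0 := by
  have hdeg : ∀ A : Finset α, A.card ≤ r → ∃ d : ℕ,
      (E.filter (A ⊆ ·)).card = (q - A.card).choose (r - A.card) * d := by
    intro A hA
    rcases hA.lt_or_eq with hA | hA
    · exact hdvd A hA
    · exact ⟨_, by rw [hA]; simp; rfl⟩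
  choose! d hd using hdeg
  let W : Finset α := E.biUnion id
  have hEW : ∀ e ∈ E, e ⊆ W := fun e he => Finset.subset_biUnion_of_mem id he
  let δ : Finset α → ℤ := fun A => if A.card ≤ r then d A else 0
  have hpos : ∀ i, 0 < (q - i).choose (r - i) := fun i => Nat.choose_pos (by omega)
  have hδ : IsDegreeFunction q r W δ := by
    refine ⟨fun A hA => ?_, fun A k hAk hk => ?_⟩
    · simp only [δ]
      split_ifs with hAr
      · have h := hd A hAr
        rw [Finset.filter_eq_empty_iff.2 fun e he hAe => hA (hAe.trans (hEW e he)),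
          Finset.card_empty] at h
        have := (Nat.mul_eq_zero.1 h.symm).resolve_left (hpos _).ne'
        simp [this]
      · rfl
    · -- count the pairs `A ⊆ R ⊆ e` with `|R| = k` and `e ∈ E`
      have hcount : ∑ R ∈ W.powersetCard k with A ⊆ R, (E.filter (R ⊆ ·)).card =
          (E.filter (A ⊆ ·)).card * (r - A.card).choose (k - A.card) := by
        simp only [Finset.card_filter (fun e => _ ⊆ e) E]
        rw [Finset.sum_comm, Finset.sum_mul]
        refine Finset.sum_congr rfl fun e he => ?_
        have := sum_powersetCard_indicator (A := A) (hEW e he) hAk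
        rw [hE e he] at this
        zify
        rw [this, mul_comm]
      have hsum : ∑ R ∈ W.powersetCard k with A ⊆ R, (E.filter (R ⊆ ·)).card =
          (q - k).choose (r - k) * ∑ R ∈ W.powersetCard k with A ⊆ R, d R := by
        rw [Finset.mul_sum]
        refine Finset.sum_congr rfl fun R hR => ?_
        have hR := (Finset.mem_powersetCard.1 (Finset.mem_filter.1 hR).1).2
        rw [hd R (by omega), hR]
      have hchoose := Nat.choose_mul (n := q - A.card) (k := r - A.card) (s := k - A.card) (by omega)
      rw [show q - A.card - (k - A.card) = q - k by omega,
        show r - A.card - (k - A.card) = r - k by omega] at hchoose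
      have hmain : ∑ R ∈ W.powersetCard k with A ⊆ R, d R =
          (q - A.card).choose (k - A.card) * d A := by
        apply Nat.eq_of_mul_eq_mul_left (hpos k)
        rw [← hsum, hcount, hd A (hAk.trans hk), mul_right_comm, hchoose]
        ring
      have hδd : ∑ R ∈ W.powersetCard k with A ⊆ R, δ R =
          ∑ R ∈ W.powersetCard k with A ⊆ R, (d R : ℤ) := by
        refine Finset.sum_congr rfl fun R hR => if_pos ?_
        rw [(Finset.mem_powersetCard.1 (Finset.mem_filter.1 hR).1).2]
        exact hk
      rw [hδd, show δ A = d A from if_pos (hAk.trans hk)]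
      exact_mod_cast hmain
  obtain ⟨P, N, hPN, hcov⟩ := hδ.exists_families hqr (r + 1) fun A hA => by omega
  refine ⟨P, N, hPN, fun e he => ?_⟩
  have h1 := hcov e he.le
  have h2 := hd e he.le
  have h3 : (E.filter (e ⊆ ·)).card = if e ∈ E then 1 else 0 := by
    rw [Finset.filter_congr (q := fun f => f = e) fun f hf => ?_, Finset.filter_eq']
    · split_ifs <;> simp
    · exact ⟨fun h => (Finset.eq_of_subset_of_card_le h (by rw [he, hE f hf])).symm,
        fun h => h ▸ subset_rfl⟩
  rw [h3, he] at h2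
  simp only [δ, he, le_refl, if_true] at h1
  simp only [Nat.sub_self, Nat.choose_zero_right, one_mul] at h2
  rw [← h2] at h1
  omega

end Integral

/-! ### Decompositions from families, and absorbers -/

section Extraction

variable {α : Type*}

/-- The complete `r`-graph with vertex set `Q`. -/
def completeOn (r : ℕ) (Q : Finset α) : Hypergraph α where
  vertexSet := Q
  edgeSet := {e | e ⊆ Q ∧ e.ncard = r}
  subset_vertexSet_of_mem_edgeSet' := fun _ he => he.1

lemma isIsomorphicCopy_completeOn {q r : ℕ} {Q : Finset α} (hQ : Q.card = q) :
    IsIsomorphicCopy (completeRGraph q r) (completeOn r Q) := by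
  let ε := (Q.equivFinOfCardEq hQ).symm
  have hinj : Function.Injective fun i => (ε i : α) :=
    Subtype.val_injective.comp ε.injective
  have hrange : Set.range (fun i => (ε i : α)) = Q := by
    ext x
    constructor
    · rintro ⟨i, rfl⟩
      exact (ε i).2
    · intro hx
      exact ⟨ε.symm ⟨x, hx⟩, by simp⟩
  refine ⟨fun i => ε i, hinj.injOn, ?_⟩
  ext e
  · simp [completeOn, completeRGraph, Hypergraph.image, ← hrange]
  · simp only [Hypergraph.mem_edgeSet_image, completeOn, completeRGraph, Set.mem_ofPred_eq]
    constructor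
    · rintro ⟨heQ, he⟩
      rw [← hrange] at heQ
      obtain ⟨e', rfl⟩ := Set.subset_range_iff_exists_image_eq.1 heQ
      exact ⟨e', by rwa [Set.ncard_image_of_injective _ hinj] at he, rfl⟩
    · rintro ⟨e', he', rfl⟩
      exact ⟨hrange ▸ Set.image_subset_range _ _, by
        rwa [Set.ncard_image_of_injective _ hinj]⟩

/-- A family of `q`-sets covering every edge of `G` once, and no other `r`-set, decomposes `G`. -/
lemma hasDecomposition_of_cov {q r : ℕ} {G : Hypergraph α} {P : Multiset (Finset α)}
    (hPq : ∀ Q ∈ P, Q.card = q) (hPG : ∀ Q ∈ P, (Q : Set α) ⊆ G.vertexSet)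
    (hGr : ∀ e ∈ G.edgeSet, ∃ f : Finset α, f.card = r ∧ (f : Set α) = e)
    (hmem : ∀ f : Finset α, f.card = r → 0 < cov P f → (f : Set α) ∈ G.edgeSet)
    (hcov : ∀ f : Finset α, (f : Set α) ∈ G.edgeSet → cov P f = 1) :
    HasDecomposition (completeRGraph q r) G := by
  classical
  refine ⟨{H | ∃ Q ∈ P, H = completeOn r Q}, ?_, ?_⟩
  · rintro H ⟨Q, hQ, rfl⟩
    refine ⟨isIsomorphicCopy_completeOn (hPq Q hQ), hPG Q hQ, ?_⟩
    rintro e ⟨heQ, he⟩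
    lift e to Finset α using Q.finite_toSet.subset heQ
    rw [Set.ncard_coe_finset] at he
    exact hmem e he (cov_pos_iff.2 ⟨Q, hQ, by simpa using heQ⟩)
  · intro e he
    obtain ⟨f, hf, rfl⟩ := hGr e he
    have h1 := hcov f he
    obtain ⟨Q, hQ, hfQ⟩ := cov_pos_iff.1 (h1 ▸ Nat.one_pos : 0 < cov P f)
    refine ⟨completeOn r Q, ⟨⟨Q, hQ, rfl⟩, by simpa using hfQ, by simpa using hf⟩, ?_⟩
    rintro _ ⟨⟨Q', hQ', rfl⟩, hfQ', -⟩
    -- a second member of `P` containing `f` would be left after erasing `Q`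
    by_contra hne
    have hQQ' : Q' ≠ Q := fun h => hne (by rw [h])
    have h2 := cov_erase hQ f
    have h3 : 0 < cov (P.erase Q) f :=
      cov_pos_iff.2 ⟨Q', (Multiset.mem_erase_of_ne hQQ').2 hQ', by simpa using hfQ'⟩
    rw [if_pos hfQ] at h2
    omega

end Extraction

end Absorbers

open Absorbers

theorem mainTheorem1 {α : Type*} [Infinite α] (q r : ℕ) (hr : 1 ≤ r) (hqr : r < q)
    (L : Hypergraph α) (hL : Absorbers.IsRGraph r L) (hdiv : Absorbers.IsDivisible q r L) :
    ∃ A : Hypergraph α, Absorbers.IsAbsorber q r L A := by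
  classical
  obtain ⟨VL, hVL⟩ := hL.finite_vertexSet.exists_finset_coe
  -- the edges of `L`, as finsets
  let E : Finset (Finset α) := VL.powerset.filter fun e => (e : Set α) ∈ L.edgeSet
  have hEmem : ∀ e : Finset α, e ∈ E ↔ (e : Set α) ∈ L.edgeSet := fun e => by
    simp only [E, Finset.mem_filter, Finset.mem_powerset, and_iff_right_iff_imp]
    intro he
    have := L.subset_vertexSet_of_mem_edgeSet' he
    rwa [← hVL, Finset.coe_subset] at this
  have hEcard : ∀ e ∈ E, e.card = r := fun e he => by
    simpa using hL.ncard_edge _ ((hEmem e).1 he)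
  have hLfin : ∀ e ∈ L.edgeSet, ∃ f ∈ E, (f : Set α) = e := fun e he => by
    have hsub := L.subset_vertexSet_of_mem_edgeSet' he
    lift e to Finset α using hL.finite_vertexSet.subset hsub
    exact ⟨e, (hEmem e).2 he, rfl⟩
  obtain ⟨P, N, hPN, hcov⟩ := exists_families_of_dvd hqr.le E hEcard fun A hA => by
    by_cases hAV : (A : Set α) ⊆ L.vertexSet
    · have h := hdiv A.card hA A hAV (by simp)
      have heq : {e | e ∈ L.edgeSet ∧ (A : Set α) ⊆ e} =
          (fun e : Finset α => (e : Set α)) '' (E.filter (A ⊆ ·) : Finset (Finset α)) := by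
        ext e
        constructor
        · rintro ⟨he, hAe⟩
          obtain ⟨f, hf, rfl⟩ := hLfin e he
          exact ⟨f, by simpa [hf] using hAe, rfl⟩
        · rintro ⟨f, hf, rfl⟩
          simp only [Finset.coe_filter, Set.mem_ofPred_eq] at hf
          exact ⟨(hEmem f).1 hf.1, by simpa using hf.2⟩
      rwa [heq, Set.ncard_image_of_injective _ Finset.coe_injective, Set.ncard_coe_finset] at h
    · rw [Finset.filter_eq_empty_iff.2]
      · simp
      · intro e he hAe
        exact hAV ((Finset.coe_subset.2 hAe).trans
          (L.subset_vertexSet_of_mem_edgeSet' ((hEmem e).1 he)))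
  obtain ⟨U, hU⟩ := exists_forall_subset (P + N)
  -- multiplicities are to be cancelled inside `W`; outside `W` nothing is covered so far
  let W := VL ∪ U
  have hzero : ∀ R ⊆ P + N, ∀ e : Finset α, ¬ e ⊆ W → cov R e = 0 := fun R hR e he => by
    by_contra h0
    obtain ⟨Q, hQ, heQ⟩ := cov_pos_iff.1 (Nat.pos_of_ne_zero h0)
    exact he ((heQ.trans (hU Q (hR hQ))).trans Finset.subset_union_right)
  have hsimple : IsSimpleOff q r W P N := ⟨hPN,
    fun e _ heW => by rw [hzero P (fun Q hQ => by simp [hQ]) e heW]; simp,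
    fun e _ heW => by rw [hzero N (fun Q hQ => by simp [hQ]) e heW]; simp⟩
  obtain ⟨P', N', h', hc, hN0⟩ := hsimple.exists_cov_eq_zero _
    (fun e _ he => by rw [hcov e he]; exact Nat.le_add_right _ _) rfl
  have hcov' : ∀ e : Finset α, e.card = r → cov P' e = cov N' e + if e ∈ E then 1 else 0 :=
    fun e he => by
      have := hc e he
      have := hcov e he
      omega
  have hEW : ∀ e ∈ E, e ⊆ W := fun e he =>
    (Finset.mem_powerset.1 (Finset.mem_filter.1 he).1).trans Finset.subset_union_left
  have hN1 : ∀ e : Finset α, e.card = r → cov N' e ≤ 1 := fun e he => by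
    by_cases heW : e ⊆ W
    · rw [hN0 e heW he]; simp
    · exact h'.right_le e he heW
  obtain ⟨V, hV⟩ := exists_forall_subset (P' + N')
  let A : Hypergraph α :=
    { vertexSet := (W ∪ V : Finset α)
      edgeSet := {e | ∃ f : Finset α, f.card = r ∧ 0 < cov N' f ∧ (f : Set α) = e}
      subset_vertexSet_of_mem_edgeSet' := by
        rintro _ ⟨f, -, hf, rfl⟩
        obtain ⟨Q, hQ, hfQ⟩ := cov_pos_iff.1 hf
        exact Finset.coe_subset.2 ((hfQ.trans (hV Q (by simp [hQ]))).trans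
          Finset.subset_union_right) }
  have hAmem : ∀ f : Finset α, (f : Set α) ∈ A.edgeSet ↔ f.card = r ∧ 0 < cov N' f := fun f => by
    constructor
    · rintro ⟨f', h1, h2, h3⟩
      rw [Finset.coe_injective h3] at h1 h2
      exact ⟨h1, h2⟩
    · rintro ⟨h1, h2⟩
      exact ⟨f, h1, h2, rfl⟩
  have hAV : ∀ Q ∈ P' + N', (Q : Set α) ⊆ A.vertexSet := fun Q hQ =>
    Finset.coe_subset.2 ((hV Q hQ).trans Finset.subset_union_right)
  refine ⟨A, ⟨Finset.finite_toSet _, ?_⟩, ?_, ?_, ?_, ?_⟩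
  · rintro _ ⟨f, hf, -, rfl⟩
    simpa using hf
  · rw [← hVL]
    exact Finset.coe_subset.2 (Finset.subset_union_left.trans Finset.subset_union_left)
  · rintro _ ⟨f, hf, hpos, rfl⟩ hsub
    rw [← hVL, Finset.coe_subset] at hsub
    exact hpos.ne' (hN0 f (hsub.trans Finset.subset_union_left) hf)
  · refine hasDecomposition_of_cov (P := N') (fun Q hQ => h'.card_eq Q (by simp [hQ]))
      (fun Q hQ => hAV Q (by simp [hQ])) ?_ (fun f hf hpos => (hAmem f).2 ⟨hf, hpos⟩) fun f hf => ?_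
    · rintro _ ⟨f, hf, -, rfl⟩
      exact ⟨f, hf, rfl⟩
    · obtain ⟨h1, h2⟩ := (hAmem f).1 hf
      have := hN1 f h1
      omega
  · refine hasDecomposition_of_cov (P := P') (fun Q hQ => h'.card_eq Q (by simp [hQ]))
      (fun Q hQ => (hAV Q (by simp [hQ])).trans Set.subset_union_right) ?_ (fun f hf hpos => ?_)
      fun f hf => ?_
    · rintro e (he | ⟨f, hf, -, rfl⟩)
      · obtain ⟨f, hf, rfl⟩ := hLfin e he
        exact ⟨f, hEcard f hf, rfl⟩
      · exact ⟨f, hf, rfl⟩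
    · rw [hcov' f hf] at hpos
      by_cases hfE : f ∈ E
      · exact Or.inl ((hEmem f).1 hfE)
      · exact Or.inr ((hAmem f).2 ⟨hf, by simpa [hfE] using hpos⟩)
    · by_cases hfE : f ∈ E
      · rw [hcov' f (hEcard f hfE), hN0 f (hEW f hfE) (hEcard f hfE), if_pos hfE]
      · obtain ⟨h1, h2⟩ := (hAmem f).1 (hf.resolve_left fun h => hfE ((hEmem f).2 h))
        have := hN1 f h1
        rw [hcov' f h1, if_neg hfE]
        omega
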